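/- Let $p\ge 3$ be a prime, let $d\neq 0$ be a rational number whose numerator (in lowest terms) is not divisible by $p$, and let $x\in\mathbb Z_p$ be a $p$-adic integer. Let $\langle x\rangle_p\in\{0,1,\dots,p-1\}$ be the least nonnegative residue of $x$ modulo $p$ and put $m:=(x-\langle x\rangle_p)/p\in\mathbb Z_p$. Write $\binom{y}{k}=y(y-1)\cdots(y-k+1)/k!$ for the generalized binomial coefficient, $H_n^{(2)}=\sum_{k=1}^n 1/k^2$, $q_p(2)=(2^{p-1}-1)/p$, and $$S:=\sum_{k=0}^{\frac{p-1}{2}}\left(x^2+x-(1+4d)k^2-(1-2d)k\right)\frac{d^{-k}\binom{x}{k}\binom{x+k}{k}}{\binom{2k}{k}} .$$ Here $A\equiv B\pmod{p^n}$ means $A-B\in p^n\mathbb Z_p$. Then the following hold. (1) If $p>3$ and $\langle x\rangle_p<(p-1)/2$, then $$S\equiv \frac{(-1)^{\langle x\rangle_p}\,m\left(-\frac1d\right)^{(p-1)/2}}{2\binom{p-1}{\langle x\rangle_p+(p-1)/2}}\left(p+2\langle x\rangle_p\,p+(1+2m)p^2+(1+2\langle x\rangle_p)\,m\,p^3\left(H^{(2)}_{\langle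 x\rangle_p}-4H^{(2)}_{2\langle x\rangle_p}\right)\right)\pmod{p^4}.$$ (2) If $p>3$ and $\langle x\rangle_p=(p-1)/2$, then $$S\equiv \frac{m(1+m)p^2}{4^{p-1}d^{\frac{p-1}{2}}}\left(1+2p\,q_p(2)+p^2q_p(2)^2\right)\pmod{p^5}.$$ (3) If $\langle x\rangle_p>(p-1)/2$, then $$S\equiv \frac{(1+m)p}{d^{\frac{p-1}{2}}}\binom{\langle x\rangle_p+\frac{p+1}{2}}{p+1}\pmod{p^2}.$$ -/

import Mathlib

/-- The generalized harmonic number `H_n^{(r)} = ∑_{k=1}^n 1 / k^r`. -/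
def genHarmonic (r n : ℕ) : ℚ :=
  ∑ k ∈ Finset.Icc 1 n, 1 / (k : ℚ) ^ r

/-- The Fermat quotient `q_p(a) = (a^{p-1} - 1) / p`. -/
def fermatQuotient (p : ℕ) (a : ℤ) : ℚ :=
  ((a : ℚ) ^ (p - 1) - 1) / (p : ℚ)

/-- `a ≡ b (mod p^n)` for `a, b ∈ ℚ_p`: the difference `a - b` lies in `p^n ℤ_p`. -/
def PadicCongr (p : ℕ) [Fact p.Prime] (n : ℕ) (a b : ℚ_[p]) : Prop :=
  ∃ z : ℤ_[p], a - b = (p : ℚ_[p]) ^ n * (z : ℚ_[p])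

/-- The least nonnegative residue of the `p`-adic integer `x` modulo `p`. -/
noncomputable def leastResidue (p : ℕ) [Fact p.Prime] (x : ℤ_[p]) : ℕ :=
  (PadicInt.toZMod x).val

/-- The sum over `0 ≤ k ≤ (p-1)/2` of
`(x² + x - (1+4d) k² - (1-2d) k) · d^{-k} · C(x,k) · C(x+k,k) / C(2k,k)`,
where `C(y,k) = y (y-1) ⋯ (y-k+1) / k!` is the generalized binomial coefficient,
a `p`-adic integer for `y ∈ ℤ_p`. -/
noncomputable def halfSum (p : ℕ) [Fact p.Prime] (d : ℚ) (x : ℤ_[p]) : ℚ_[p] :=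
  ∑ k ∈ Finset.range ((p - 1) / 2 + 1),
    ((x : ℚ_[p]) ^ 2 + (x : ℚ_[p]) - (1 + 4 * (d : ℚ_[p])) * (k : ℚ_[p]) ^ 2
        - (1 - 2 * (d : ℚ_[p])) * (k : ℚ_[p]))
      * (((d : ℚ_[p]) ^ k)⁻¹ * ((Ring.choose x k : ℤ_[p]) : ℚ_[p])
          * ((Ring.choose (x + (k : ℤ_[p])) k : ℤ_[p]) : ℚ_[p])
          / ((Nat.choose (2 * k) k : ℕ) : ℚ_[p]))

open Finset

variable {p : ℕ} [Fact p.Prime]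

/-! The sum telescopes (`telescoped_sum`): with `p = 2n + 1` it equals `d⁻ⁿ / (2n)!` times the
product of the `p + 1` consecutive factors `x - n, …, x + n + 1`. Put `x = a + pM`, where `a` is the
residue of `x`.

If `a ≤ n`, the factor `pM` splits off. Dividing each of the others except the last by its residue
leaves a product of terms `1 ± pM/i`. Pairing `i` with `p - i` and using that `∑ 1/i²` over `i ≤ n`
vanishes mod `p` evaluates it mod `p³` (`pow_three_dvd_prod_sub`). For `a = n` the last factor is
`p(1 + M)`, which gives one more power of `p`.

If `a > n`, one factor is `p + pM`, and the others are needed only mod `p`, where `x` may be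
replaced by `a`. -/

/-! ### Binomial coefficients and telescoping. -/

theorem factorial_mul_ringChoose {R : Type*} [CommRing R] [BinomialRing R] (x : R) (k : ℕ) :
    (k.factorial : R) * Ring.choose x k = ∏ j ∈ range k, (x - j) := by
  have h := Ring.descPochhammer_eq_factorial_smul_choose x k
  rw [nsmul_eq_mul] at h
  rw [← h]
  clear h
  induction k with
  | zero => simp
  | succ k ih =>
    simp [prod_range_succ, ← ih, descPochhammer_succ_right, Polynomial.smeval_mul,
      Polynomial.smeval_natCast]

theorem factorial_mul_ringChoose_add {R : Type*} [CommRing R] [BinomialRing R] (x : R) (k : ℕ) :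
    (k.factorial : R) * Ring.choose (x + k) k = ∏ j ∈ range k, (x + j + 1) := by
  rw [factorial_mul_ringChoose, ← prod_range_reflect]
  refine prod_congr rfl fun j hj => ?_
  have hj' : k - 1 - j + (j + 1) = k := by have := mem_range.1 hj; omega
  have : ((k - 1 - j : ℕ) : R) + (j + 1) = k := by
    have := congrArg (Nat.cast : ℕ → R) hj'
    rwa [Nat.cast_add, Nat.cast_succ] at this
  linear_combination -this

/-- The quadratic factor is `(x - k)(x + k + 1) - 2k(2k - 1)d`, so the `k`-th summand is the
difference of consecutive values of the right-hand side. -/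
theorem telescoped_sum {K : Type*} [Field K] [CharZero K] (d x : K) (hd : d ≠ 0) (n : ℕ) :
    ∑ k ∈ range (n + 1), (x ^ 2 + x - (1 + 4 * d) * (k : K) ^ 2 - (1 - 2 * d) * k)
        * ((d ^ k)⁻¹ * (∏ j ∈ range k, (x - j)) * (∏ j ∈ range k, (x + j + 1))
          / ((2 * k).factorial : K))
      = (d ^ n)⁻¹ * (∏ j ∈ range (n + 1), (x - j)) * (∏ j ∈ range (n + 1), (x + j + 1))
          / ((2 * n).factorial : K) := by
  induction n with
  | zero => simp; ring
  | succ n ih =>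
    rw [sum_range_succ, ih]
    have hf : ((2 * n).factorial : K) ≠ 0 := by exact_mod_cast (2 * n).factorial_ne_zero
    have h1 : (2 * (n : K) + 1) ≠ 0 := by exact_mod_cast (2 * n).succ_ne_zero
    have h2 : (n : K) + 1 ≠ 0 := by exact_mod_cast n.succ_ne_zero
    have e : 2 * (n + 1) = 2 * n + 1 + 1 := by ring
    rw [e, Nat.factorial_succ, Nat.factorial_succ, prod_range_succ _ (n + 1),
      prod_range_succ _ (n + 1), pow_succ]
    push_cast
    rw [show 2 * (n : K) + 1 + 1 = 2 * (n + 1) by ring]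
    generalize ∏ j ∈ range (n + 1), (x - (j : K)) = A
    generalize ∏ j ∈ range (n + 1), (x + (j : K) + 1) = B
    generalize ((2 * n).factorial : K) = F at *
    generalize (n : K) = N at *
    have h3 : N * 2 + 1 ≠ 0 := by rwa [mul_comm]
    field_simp
    ring

/-! ### Congruences as divisibility in `ℤ_[p]`, and inverses of units. -/

theorem padicCongr_coe_iff {n : ℕ} {u w : ℤ_[p]} :
    PadicCongr p n (u : ℚ_[p]) w ↔ (p : ℤ_[p]) ^ n ∣ u - w := by
  constructor
  · rintro ⟨z, hz⟩
    exact ⟨z, Subtype.ext (by push_cast; exact hz)⟩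
  · rintro ⟨z, hz⟩
    exact ⟨z, by exact_mod_cast congrArg (Subtype.val : ℤ_[p] → ℚ_[p]) hz⟩

theorem dvd_iff_toZMod_eq_zero {z : ℤ_[p]} : (p : ℤ_[p]) ∣ z ↔ PadicInt.toZMod z = 0 := by
  rw [← RingHom.mem_ker, PadicInt.ker_toZMod, PadicInt.maximalIdeal_eq_span_p,
    Ideal.mem_span_singleton]

theorem natCast_mul_inv {i : ℕ} (h0 : i ≠ 0) (hi : i < p) :
    (i : ℤ_[p]) * (i : ℤ_[p]).inv = 1 :=
  PadicInt.mul_inv (PadicInt.norm_natCast_eq_one_iff.2 (Nat.coprime_of_lt_prime h0 hi Fact.out))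

theorem coe_natCast_inv {i : ℕ} (h0 : i ≠ 0) (hi : i < p) :
    ((i : ℤ_[p]).inv : ℚ_[p]) = (i : ℚ_[p])⁻¹ := by
  have h := congrArg (Subtype.val : ℤ_[p] → ℚ_[p]) (natCast_mul_inv h0 hi)
  push_cast at h
  exact eq_inv_of_mul_eq_one_right h

theorem toZMod_natCast_inv {i : ℕ} (h0 : i ≠ 0) (hi : i < p) :
    PadicInt.toZMod (i : ℤ_[p]).inv = (i : ZMod p)⁻¹ := by
  have h := congrArg (PadicInt.toZMod (p := p)) (natCast_mul_inv h0 hi)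
  rw [map_mul, map_natCast, map_one] at h
  exact eq_inv_of_mul_eq_one_right h

theorem natCast_factorial_mul_inv {k : ℕ} (hk : k < p) :
    (k.factorial : ℤ_[p]) * (k.factorial : ℤ_[p]).inv = 1 := by
  refine PadicInt.mul_inv (PadicInt.norm_natCast_eq_one_iff.2 ?_)
  rw [Nat.Prime.coprime_iff_not_dvd Fact.out, Nat.Prime.dvd_factorial Fact.out]
  omega

theorem exists_coe_eq_inv {d : ℚ} (hd : ¬ (p : ℤ) ∣ d.num) :
    ∃ D : ℤ_[p], (D : ℚ_[p]) = (d : ℚ_[p])⁻¹ := by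
  refine ⟨⟨((d⁻¹ : ℚ) : ℚ_[p]), Padic.norm_rat_le_one ?_⟩, by push_cast; rfl⟩
  rw [Rat.den_inv_of_ne_zero (by rintro rfl; simp at hd)]
  rwa [Int.natCast_dvd] at hd

theorem sq_dvd_prod_one_add_sub {R ι : Type*} [CommRing R] (q : R) (s : Finset ι)
    (f : ι → R) (hf : ∀ i ∈ s, q ∣ f i) :
    q ^ 2 ∣ ∏ i ∈ s, (1 + f i) - (1 + ∑ i ∈ s, f i) := by
  classical
  induction s using Finset.induction_on with
  | empty => simp
  | insert i s hi ih =>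
    rw [prod_insert hi, sum_insert hi]
    obtain ⟨c, hc⟩ := ih fun j hj => hf j (mem_insert_of_mem hj)
    obtain ⟨u, hu⟩ := hf i (mem_insert_self i s)
    obtain ⟨w, hw⟩ := dvd_sum fun j hj => hf j (mem_insert_of_mem hj)
    refine ⟨c * (1 + f i) + u * w, ?_⟩
    linear_combination (1 + f i) * hc + (∑ j ∈ s, f j) * hu + q * u * hw

/-! ### Sums of inverse squares modulo `p`. -/

theorem natCast_ne_zero_zmod {i : ℕ} (h0 : i ≠ 0) (hi : i < p) : (i : ZMod p) ≠ 0 := by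
  rw [Ne, ZMod.natCast_eq_zero_iff]
  exact Nat.not_dvd_of_pos_of_lt (Nat.pos_of_ne_zero h0) hi

/-- Inversion permutes `ZMod p` (with `0⁻¹ = 0`), and the power sum of exponent `2 < p - 1`
vanishes. -/
theorem sum_inv_sq_zmod (hp : 3 < p) :
    ∑ i ∈ range (p - 1), (((i + 1 : ℕ) : ZMod p)⁻¹) ^ 2 = 0 := by
  have hp5 : 2 < p - 1 := by
    have : p ≠ 4 := by rintro rfl; exact absurd (Fact.out : Nat.Prime 4) (by norm_num)
    omega
  have h1 : ∑ y : ZMod p, (y⁻¹) ^ 2 = 0 := by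
    refine (Function.Bijective.sum_comp inv_involutive.bijective (fun y : ZMod p => y ^ 2)).trans ?_
    exact FiniteField.sum_pow_lt_card_sub_one _ _ (by rwa [ZMod.card])
  have h2 : ∑ y : ZMod p, (y⁻¹) ^ 2 = ∑ i ∈ range p, ((i : ZMod p)⁻¹) ^ 2 := by
    refine sum_nbij' (fun y => y.val) (fun i => (i : ZMod p)) ?_ ?_ ?_ ?_ ?_
    · intro y _; exact mem_range.2 (ZMod.val_lt y)
    · intro i _; exact mem_univ _
    · intro y _; simp
    · intro i hi; exact ZMod.val_cast_of_lt (mem_range.1 hi)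
    · intro y _; simp
  rw [h1] at h2
  have e : range p = range (p - 1 + 1) := by congr 1; omega
  rw [e, sum_range_succ'] at h2
  simpa using h2.symm

theorem sum_half_inv_sq_zmod {n : ℕ} (hn : p = 2 * n + 1) (hp : 3 < p) :
    ∑ i ∈ range n, (((i + 1 : ℕ) : ZMod p)⁻¹) ^ 2 = 0 := by
  have h := sum_inv_sq_zmod hp
  have e : p - 1 = n + n := by omega
  rw [e, sum_range_add] at h
  have h2 : ∑ j ∈ range n, (((n + j + 1 : ℕ) : ZMod p)⁻¹) ^ 2
      = ∑ i ∈ range n, (((i + 1 : ℕ) : ZMod p)⁻¹) ^ 2 := by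
    rw [← sum_range_reflect (fun i => (((i + 1 : ℕ) : ZMod p)⁻¹) ^ 2)]
    refine sum_congr rfl fun j hj => ?_
    have hj' : (n + j + 1) + (n - 1 - j + 1) = p := by have := mem_range.1 hj; omega
    have : ((n + j + 1 : ℕ) : ZMod p) = -((n - 1 - j + 1 : ℕ) : ZMod p) := by
      rw [eq_neg_iff_add_eq_zero]
      exact_mod_cast (congrArg (Nat.cast : ℕ → ZMod p) hj').trans (ZMod.natCast_self p)
    rw [this, inv_neg, neg_sq]
  rw [h2, ← two_mul] at h
  refine (mul_eq_zero.1 h).resolve_left ?_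
  exact_mod_cast natCast_ne_zero_zmod (p := p) two_ne_zero (by omega)

theorem sum_complement_inv_sq_zmod {a b : ℕ} (hn : p = 2 * (a + b) + 1) (hp : 3 < p) :
    ∑ i ∈ range b, (((i + 1 : ℕ) : ZMod p)⁻¹) ^ 2
      + ∑ j ∈ range a, (((a + b + j + 1 : ℕ) : ZMod p)⁻¹) ^ 2 = 0 := by
  have h := sum_half_inv_sq_zmod hn hp
  rw [add_comm a b, sum_range_add] at h
  rw [← h]
  congr 1
  rw [← sum_range_reflect (fun i => (((b + i + 1 : ℕ) : ZMod p)⁻¹) ^ 2)]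
  refine sum_congr rfl fun j hj => ?_
  have hj' : (a + b + j + 1) + (b + (a - 1 - j) + 1) = p := by have := mem_range.1 hj; omega
  have : ((a + b + j + 1 : ℕ) : ZMod p) = -((b + (a - 1 - j) + 1 : ℕ) : ZMod p) := by
    rw [eq_neg_iff_add_eq_zero]
    exact_mod_cast (congrArg (Nat.cast : ℕ → ZMod p) hj').trans (ZMod.natCast_self p)
  rw [this, inv_neg, neg_sq]

/-- Modulo `p`, `n + j + 1` is `(2j + 1)/2`, so the left side is four times a sum over odd
denominators: all denominators up to `2a` minus the even ones. -/
theorem sum_shifted_inv_sq_zmod {n a : ℕ} (hn : p = 2 * n + 1) (ha : a ≤ n) :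
    ∑ j ∈ range a, (((n + j + 1 : ℕ) : ZMod p)⁻¹) ^ 2
      = 4 * ∑ i ∈ range (2 * a), (((i + 1 : ℕ) : ZMod p)⁻¹) ^ 2
        - ∑ i ∈ range a, (((i + 1 : ℕ) : ZMod p)⁻¹) ^ 2 := by
  induction a with
  | zero => simp
  | succ a ih =>
    have e : 2 * (a + 1) = 2 * a + 1 + 1 := by ring
    rw [sum_range_succ, ih (by omega), e, sum_range_succ, sum_range_succ, sum_range_succ]
    have h2 : (2 : ZMod p) ≠ 0 := by
      exact_mod_cast natCast_ne_zero_zmod (p := p) two_ne_zero (by omega)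
    have h1 : ((n + a + 1 : ℕ) : ZMod p) = ((2 * a + 1 : ℕ) : ZMod p) / 2 := by
      rw [eq_div_iff h2]
      have : (n + a + 1) * 2 = p + (2 * a + 1) := by omega
      have := congrArg (Nat.cast : ℕ → ZMod p) this
      rw [Nat.cast_add p, ZMod.natCast_self, zero_add] at this
      exact_mod_cast this
    have h3 : ((2 * a + 1 + 1 : ℕ) : ZMod p) = 2 * ((a + 1 : ℕ) : ZMod p) := by
      push_cast; ring
    rw [h1, h3, inv_div, div_eq_mul_inv, mul_inv]
    have h4 : (2 : ZMod p) * 2⁻¹ = 1 := mul_inv_cancel₀ h2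
    linear_combination (-(2 * 2⁻¹ + 1) * (((a + 1 : ℕ) : ZMod p)⁻¹) ^ 2) * h4

/-! ### The unit product modulo `p³`. -/

theorem prod_range_two_mul_add {M : Type*} [CommMonoid M] (f : ℕ → M) (a b : ℕ) :
    ∏ i ∈ range (2 * a + b), f (i + 1)
      = (∏ i ∈ range b, f (i + 1))
        * ∏ j ∈ range a, (f (a + b + j + 1) * f (b + (a - 1 - j) + 1)) := by
  rw [show 2 * a + b = b + (a + a) by ring, prod_range_add, prod_range_add, prod_mul_distrib,
    prod_range_reflect (fun j => f (b + j + 1)), mul_comm (∏ j ∈ range a, f (a + b + j + 1))]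
  congr 2
  exact prod_congr rfl fun j _ => congrArg f (by ring)

/-- Indices above `b` pair up as `i + k = p`, and `1/i + 1/k = p/(ik)` removes the term linear in
`p`. Indices up to `b` combine with the second product into `1 - p²M²/i²`. To first order in `p²`
only three sums mod `p` matter, and all are `±Z`. -/
theorem pow_three_dvd_prod_sub {a b : ℕ} (hn : p = 2 * (a + b) + 1) (hp : 3 < p) (M : ℤ_[p]) :
    (p : ℤ_[p]) ^ 3 ∣
      (∏ i ∈ range (2 * a + b), (1 + p * M * ((i + 1 : ℕ) : ℤ_[p]).inv))
        * (∏ i ∈ range b, (1 - p * M * ((i + 1 : ℕ) : ℤ_[p]).inv))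
      - (1 - p ^ 2 * M * ∑ j ∈ range a, ((a + b + j + 1 : ℕ) : ℤ_[p]).inv ^ 2) := by
  have hpair : ∀ j ∈ range a,
      (1 + p * M * ((a + b + j + 1 : ℕ) : ℤ_[p]).inv)
          * (1 + p * M * ((b + (a - 1 - j) + 1 : ℕ) : ℤ_[p]).inv)
        = 1 + p ^ 2 * (M * (1 + M) * (((a + b + j + 1 : ℕ) : ℤ_[p]).inv
            * ((b + (a - 1 - j) + 1 : ℕ) : ℤ_[p]).inv)) := by
    intro j hj
    have hj := mem_range.1 hj
    have h1 := natCast_mul_inv (p := p) (i := a + b + j + 1) (by omega) (by omega)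
    have h2 := natCast_mul_inv (p := p) (i := b + (a - 1 - j) + 1) (by omega) (by omega)
    have h3 : ((a + b + j + 1 : ℕ) : ℤ_[p]) + ((b + (a - 1 - j) + 1 : ℕ) : ℤ_[p]) = p := by
      rw [← Nat.cast_add]; congr 1; omega
    generalize ((a + b + j + 1 : ℕ) : ℤ_[p]) = i at *
    generalize ((b + (a - 1 - j) + 1 : ℕ) : ℤ_[p]) = k at *
    linear_combination p * M * i.inv * k.inv * h3 - p * M * k.inv * h1 - p * M * i.inv * h2
  rw [prod_range_two_mul_add (fun i => 1 + p * M * (i : ℤ_[p]).inv), prod_congr rfl hpair,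
    mul_right_comm, ← prod_mul_distrib]
  have hsq : ∀ i ∈ range b, (1 + p * M * ((i + 1 : ℕ) : ℤ_[p]).inv)
      * (1 - p * M * ((i + 1 : ℕ) : ℤ_[p]).inv)
        = 1 + p ^ 2 * (-M ^ 2 * ((i + 1 : ℕ) : ℤ_[p]).inv ^ 2) := fun i _ => by ring
  rw [prod_congr rfl hsq]
  obtain ⟨c, hc⟩ := sq_dvd_prod_one_add_sub ((p : ℤ_[p]) ^ 2) (range b)
    (fun i => p ^ 2 * (-M ^ 2 * ((i + 1 : ℕ) : ℤ_[p]).inv ^ 2)) fun _ _ => dvd_mul_right _ _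
  obtain ⟨e, he⟩ := sq_dvd_prod_one_add_sub ((p : ℤ_[p]) ^ 2) (range a)
    (fun j => p ^ 2 * (M * (1 + M) * (((a + b + j + 1 : ℕ) : ℤ_[p]).inv
            * ((b + (a - 1 - j) + 1 : ℕ) : ℤ_[p]).inv))) fun _ _ => dvd_mul_right _ _
  simp only [← mul_sum] at hc he
  set X := ∑ i ∈ range b, ((i + 1 : ℕ) : ℤ_[p]).inv ^ 2 with hX
  set Y := ∑ j ∈ range a, ((a + b + j + 1 : ℕ) : ℤ_[p]).inv
            * ((b + (a - 1 - j) + 1 : ℕ) : ℤ_[p]).inv with hY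
  set Z := ∑ j ∈ range a, ((a + b + j + 1 : ℕ) : ℤ_[p]).inv ^ 2 with hZ
  have hXZ : PadicInt.toZMod X + PadicInt.toZMod Z = 0 := by
    rw [← sum_complement_inv_sq_zmod hn hp, hX, hZ, map_sum, map_sum]
    congr 1
    · refine sum_congr rfl fun i hi => ?_
      have hi := mem_range.1 hi
      rw [map_pow, toZMod_natCast_inv (by omega) (by omega)]
    · refine sum_congr rfl fun i hi => ?_
      have hi := mem_range.1 hi
      rw [map_pow, toZMod_natCast_inv (by omega) (by omega)]
  have hYZ : PadicInt.toZMod Y = - PadicInt.toZMod Z := by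
    rw [hY, hZ, map_sum, map_sum, ← sum_neg_distrib]
    refine sum_congr rfl fun j hj => ?_
    have hj := mem_range.1 hj
    rw [map_pow, map_mul, toZMod_natCast_inv (by omega) (by omega),
      toZMod_natCast_inv (by omega) (by omega)]
    have h3 : ((a + b + j + 1 : ℕ) : ZMod p) + ((b + (a - 1 - j) + 1 : ℕ) : ZMod p) = 0 := by
      rw [← Nat.cast_add, ← ZMod.natCast_self p]; congr 1; omega
    rw [← neg_eq_of_add_eq_zero_right h3, inv_neg]
    ring
  have hdvd : (p : ℤ_[p]) ∣ -M ^ 2 * X + M * (1 + M) * Y + M * Z := by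
    rw [dvd_iff_toZMod_eq_zero]
    simp only [map_add, map_mul, map_neg, map_pow, map_one, hYZ]
    linear_combination (-(PadicInt.toZMod M) ^ 2) * hXZ
  obtain ⟨g, hg⟩ := hdvd
  rw [sub_eq_iff_eq_add] at hc he
  rw [hc, he]
  refine ⟨g + p * (c * (1 + p ^ 2 * (M * (1 + M) * Y)) + e * (1 + p ^ 2 * (-M ^ 2 * X))
    + p ^ 4 * c * e - M ^ 2 * X * (M * (1 + M) * Y)), ?_⟩
  linear_combination p ^ 2 * hg

/-! ### Factoring the closed form around a multiple of `p`. -/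

theorem prod_add_natCast {N : ℕ} (hN : N < p) (t : ℤ_[p]) :
    ∏ i ∈ range N, (t + ((i + 1 : ℕ) : ℤ_[p]))
      = N.factorial * ∏ i ∈ range N, (1 + t * ((i + 1 : ℕ) : ℤ_[p]).inv) := by
  induction N with
  | zero => simp
  | succ N ih =>
    rw [prod_range_succ, prod_range_succ, ih (by omega), Nat.factorial_succ, Nat.cast_mul]
    have h := natCast_mul_inv (p := p) N.succ_ne_zero hN
    rw [Nat.succ_eq_add_one] at h
    linear_combination (-(N.factorial : ℤ_[p])
      * (∏ i ∈ range N, (1 + t * ((i + 1 : ℕ) : ℤ_[p]).inv)) * t) * h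

theorem prod_sub_natCast {N : ℕ} (hN : N < p) (t : ℤ_[p]) :
    ∏ i ∈ range N, (t - ((i + 1 : ℕ) : ℤ_[p]))
      = (-1) ^ N * N.factorial * ∏ i ∈ range N, (1 - t * ((i + 1 : ℕ) : ℤ_[p]).inv) := by
  have h := prod_add_natCast hN (-t)
  have h2 : ∏ i ∈ range N, (t - ((i + 1 : ℕ) : ℤ_[p]))
      = (-1) ^ N * ∏ i ∈ range N, (-t + ((i + 1 : ℕ) : ℤ_[p])) := by
    rw [← card_range N, ← prod_const, card_range, ← prod_mul_distrib]
    exact prod_congr rfl fun i _ => by ring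
  rw [h2, h, mul_assoc]
  simp only [neg_mul, ← sub_eq_add_neg]

theorem prod_centered {R : Type*} [CommRing R] (t : R) (a b : ℕ) :
    (∏ j ∈ range (a + b + 1), (a + t - j)) * ∏ j ∈ range (a + b + 1), (a + t + j + 1)
      = t * (∏ i ∈ range b, (t - ((i + 1 : ℕ) : R)))
        * ((∏ i ∈ range (2 * a + b), (t + ((i + 1 : ℕ) : R))) * (t + ((2 * a + b + 1 : ℕ) : R))) := by
  rw [← prod_range_succ (fun i => t + ((i + 1 : ℕ) : R)),
    show 2 * a + b + 1 = a + (a + b + 1) by ring,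
    prod_range_add (fun i => t + ((i + 1 : ℕ) : R)) a,
    show range (a + b + 1) = range (a + (b + 1)) by rfl,
    prod_range_add (fun j : ℕ => (a : R) + t - j) a, prod_range_succ',
    ← prod_range_reflect (fun j : ℕ => (a : R) + t - j)]
  have h1 : ∏ j ∈ range a, ((a : R) + t - ((a - 1 - j : ℕ) : R))
      = ∏ i ∈ range a, (t + ((i + 1 : ℕ) : R)) := by
    refine prod_congr rfl fun j hj => ?_
    have hj' : (a - 1 - j) + (j + 1) = a := by have := mem_range.1 hj; omega
    have := congrArg (Nat.cast : ℕ → R) hj'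
    rw [Nat.cast_add] at this
    linear_combination -this
  have h2 : ∏ k ∈ range b, ((a : R) + t - ((a + (k + 1) : ℕ) : R))
      = ∏ i ∈ range b, (t - ((i + 1 : ℕ) : R)) :=
    prod_congr rfl fun i _ => by push_cast; ring
  have h3 : ∏ j ∈ range (a + (b + 1)), ((a : R) + t + j + 1)
      = ∏ i ∈ range (a + (b + 1)), (t + ((a + i + 1 : ℕ) : R)) :=
    prod_congr rfl fun i _ => by push_cast; ring
  rw [h1, h2, h3]
  push_cast
  ring

theorem prod_centered_eq_prod_range {R : Type*} [CommRing R] (t : R) (n c : ℕ) :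
    (∏ j ∈ range (n + 1), (((n + c : ℕ) : R) + t - j))
        * ∏ j ∈ range (n + 1), (((n + c : ℕ) : R) + t + j + 1)
      = ∏ i ∈ range (2 * n + 2), (t + ((c + i : ℕ) : R)) := by
  rw [show 2 * n + 2 = (n + 1) + (n + 1) by ring,
    prod_range_add (fun i => t + ((c + i : ℕ) : R)),
    ← prod_range_reflect (fun j : ℕ => ((n + c : ℕ) : R) + t - j)]
  refine congrArg₂ (· * ·) ?_ ?_
  · refine prod_congr rfl fun j hj => ?_
    have hj' : (n + 1 - 1 - j) + j = n := by have := mem_range.1 hj; omega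
    have := congrArg (Nat.cast : ℕ → R) hj'
    rw [Nat.cast_add] at this
    push_cast at this ⊢
    linear_combination -this
  · exact prod_congr rfl fun j _ => by push_cast; ring

theorem halfSum_eq {n : ℕ} (hn : p = 2 * n + 1) {d : ℚ} (hd : d ≠ 0) {D : ℤ_[p]}
    (hD : (D : ℚ_[p]) = (d : ℚ_[p])⁻¹) (x : ℤ_[p]) :
    halfSum p d x = ((D ^ n * ((2 * n).factorial : ℤ_[p]).inv
      * ((∏ j ∈ range (n + 1), (x - j)) * ∏ j ∈ range (n + 1), (x + j + 1)) : ℤ_[p]) : ℚ_[p]) := by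
  have hF := congrArg (Subtype.val : ℤ_[p] → ℚ_[p])
    (natCast_factorial_mul_inv (p := p) (k := 2 * n) (by omega))
  push_cast at hF
  have key := telescoped_sum (d : ℚ_[p]) (x : ℚ_[p]) (by exact_mod_cast hd) n
  have hcoe : ∀ k : ℕ, (∏ j ∈ range k, ((x : ℚ_[p]) - j))
      = ((∏ j ∈ range k, (x - j) : ℤ_[p]) : ℚ_[p]) := fun k => by
    induction k with
    | zero => simp
    | succ k ih => rw [prod_range_succ, prod_range_succ, ih]; push_cast; rfl
  have hcoe' : ∀ k : ℕ, (∏ j ∈ range k, ((x : ℚ_[p]) + j + 1))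
      = ((∏ j ∈ range k, (x + j + 1) : ℤ_[p]) : ℚ_[p]) := fun k => by
    induction k with
    | zero => simp
    | succ k ih => rw [prod_range_succ, prod_range_succ, ih]; push_cast; rfl
  refine Eq.trans (Eq.trans ?_ key) ?_
  · rw [halfSum, show (p - 1) / 2 = n by omega]
    refine sum_congr rfl fun k _ => ?_
    congr 1
    rw [hcoe, hcoe', ← factorial_mul_ringChoose, ← factorial_mul_ringChoose_add]
    have hc := congrArg (Nat.cast : ℕ → ℚ_[p]) (Nat.add_choose_mul_factorial_mul_factorial k k)
    rw [← two_mul] at hc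
    push_cast at hc ⊢
    have h1 : (k.factorial : ℚ_[p]) ≠ 0 := by exact_mod_cast k.factorial_ne_zero
    have h2 : (((2 * k).choose k : ℕ) : ℚ_[p]) ≠ 0 := by
      exact_mod_cast (Nat.choose_pos (by omega)).ne'
    rw [← hc]
    field_simp
  · rw [hcoe, hcoe', div_eq_mul_inv, ← eq_inv_of_mul_eq_one_right hF]
    push_cast
    rw [hD, inv_pow]
    ring

/-! ### Harmonic numbers, residues and binomials in `ℤ_[p]`. -/

theorem genHarmonic_two_coe {a : ℕ} (ha : a < p) :
    ((genHarmonic 2 a : ℚ) : ℚ_[p])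
      = ((∑ i ∈ range a, ((i + 1 : ℕ) : ℤ_[p]).inv ^ 2 : ℤ_[p]) : ℚ_[p]) := by
  induction a with
  | zero => simp [genHarmonic]
  | succ a ih =>
    have h : genHarmonic 2 (a + 1) = genHarmonic 2 a + 1 / ((a + 1 : ℕ) : ℚ) ^ 2 :=
      sum_Icc_succ_top (by omega) _
    rw [h, sum_range_succ, PadicInt.coe_add, ← ih (by omega), PadicInt.coe_pow,
      coe_natCast_inv a.succ_ne_zero ha]
    push_cast
    simp

theorem dvd_sum_shifted_inv_sq_sub {n a : ℕ} (hn : p = 2 * n + 1) (ha : a ≤ n) :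
    (p : ℤ_[p]) ∣ ∑ j ∈ range a, ((n + j + 1 : ℕ) : ℤ_[p]).inv ^ 2
      - (4 * ∑ i ∈ range (2 * a), ((i + 1 : ℕ) : ℤ_[p]).inv ^ 2
        - ∑ i ∈ range a, ((i + 1 : ℕ) : ℤ_[p]).inv ^ 2) := by
  have h : ∀ c k : ℕ, c + k < p → PadicInt.toZMod
      (∑ i ∈ range k, ((c + i + 1 : ℕ) : ℤ_[p]).inv ^ 2)
        = ∑ i ∈ range k, (((c + i + 1 : ℕ) : ZMod p)⁻¹) ^ 2 := fun c k hk => by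
    rw [map_sum]
    refine sum_congr rfl fun i hi => ?_
    have hi := mem_range.1 hi
    rw [map_pow, toZMod_natCast_inv (by omega) (by omega)]
  have h0 := h 0
  simp only [zero_add] at h0
  rw [dvd_iff_toZMod_eq_zero, map_sub, map_sub, map_mul, h _ _ (by omega), h0 _ (by omega),
    h0 _ (by omega), sum_shifted_inv_sq_zmod hn ha, map_ofNat, sub_self]

theorem exists_eq_leastResidue_add (x : ℤ_[p]) :
    ∃ M : ℤ_[p], x = (leastResidue p x : ℕ) + p * M := by
  have h : (p : ℤ_[p]) ∣ x - (leastResidue p x : ℕ) := by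
    rw [dvd_iff_toZMod_eq_zero, map_sub, map_natCast, leastResidue, ZMod.natCast_zmod_val, sub_self]
  obtain ⟨M, hM⟩ := h
  exact ⟨M, by rw [← hM]; ring⟩

theorem inv_choose_coe {b N : ℕ} (hN : N + b < p) :
    ((((N + b).choose N : ℕ) : ℚ_[p]))⁻¹
      = ((b.factorial * N.factorial * ((N + b).factorial : ℤ_[p]).inv : ℤ_[p]) : ℚ_[p]) := by
  have h := natCast_factorial_mul_inv (p := p) hN
  have hc := congrArg (Nat.cast : ℕ → ℤ_[p]) (Nat.add_choose_mul_factorial_mul_factorial b N)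
  rw [add_comm b N] at hc
  push_cast at hc
  have h1 : (((N + b).choose N : ℕ) : ℤ_[p])
      * (b.factorial * N.factorial * ((N + b).factorial : ℤ_[p]).inv) = 1 := by
    rw [← h, ← hc]; ring
  have h2 := congrArg (Subtype.val : ℤ_[p] → ℚ_[p]) h1
  rw [PadicInt.coe_mul, PadicInt.coe_natCast, PadicInt.coe_one] at h2
  exact (eq_inv_of_mul_eq_one_right h2).symm

/-! ### The three cases. -/

theorem halfSum_congr_of_lt {a b : ℕ} (hn : p = 2 * (a + b) + 1) (hp : 3 < p)
    {d : ℚ} (hd : d ≠ 0) {D : ℤ_[p]} (hD : (D : ℚ_[p]) = (d : ℚ_[p])⁻¹) (M : ℤ_[p]) :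
    PadicCongr p 4 (halfSum p d (a + p * M))
        ((-1 : ℚ_[p]) ^ a * M * (-1 / (d : ℚ_[p])) ^ (a + b)
            / (2 * ((Nat.choose (2 * a + b + b) (2 * a + b) : ℕ) : ℚ_[p]))
          * ((p : ℚ_[p]) + 2 * (a : ℚ_[p]) * (p : ℚ_[p]) + (1 + 2 * M) * (p : ℚ_[p]) ^ 2
              + (1 + 2 * (a : ℚ_[p])) * M * (p : ℚ_[p]) ^ 3
                * ((genHarmonic 2 a : ℚ_[p]) - 4 * (genHarmonic 2 (2 * a) : ℚ_[p])))) := by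
  obtain ⟨g, hg⟩ := pow_three_dvd_prod_sub hn hp M
  obtain ⟨h, hh⟩ := dvd_sum_shifted_inv_sq_sub (a := a) hn (by omega)
  have h2 := natCast_mul_inv (p := p) two_ne_zero (by omega)
  have h2' : ((2 : ℕ) : ℚ_[p])⁻¹ = _ := (coe_natCast_inv (p := p) two_ne_zero (by omega)).symm
  rw [halfSum_eq hn hd hD, prod_centered, prod_add_natCast (by omega), prod_sub_natCast (by omega),
    genHarmonic_two_coe (by omega), genHarmonic_two_coe (by omega), div_eq_mul_inv (-1 : ℚ_[p]),
    ← hD, div_eq_mul_inv, mul_inv, inv_choose_coe (by omega), ← Nat.cast_two (R := ℚ_[p]), h2',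
    show 2 * a + b + b = 2 * (a + b) by ring]
  set w := ((2 : ℕ) : ℤ_[p]).inv
  set H := ∑ i ∈ range a, ((i + 1 : ℕ) : ℤ_[p]).inv ^ 2
  set H' := ∑ i ∈ range (2 * a), ((i + 1 : ℕ) : ℤ_[p]).inv ^ 2
  set Z := ∑ j ∈ range a, ((a + b + j + 1 : ℕ) : ℤ_[p]).inv ^ 2
  set P := ∏ i ∈ range (2 * a + b), (1 + p * M * ((i + 1 : ℕ) : ℤ_[p]).inv)
  set P' := ∏ i ∈ range b, (1 - p * M * ((i + 1 : ℕ) : ℤ_[p]).inv)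
  set F := ((2 * (a + b)).factorial : ℤ_[p]).inv
  have hpc : (p : ℤ_[p]) = 2 * (a + b) + 1 := by exact_mod_cast congrArg (Nat.cast : ℕ → ℤ_[p]) hn
  have key := (padicCongr_coe_iff (p := p) (n := 4)
    (u := D ^ (a + b) * F * (p * M * ((-1) ^ b * b.factorial * P')
      * (((2 * a + b).factorial * P) * (p * M + ((2 * a + b + 1 : ℕ) : ℤ_[p])))))
    (w := (-1) ^ a * M * (-1 * D) ^ (a + b) * (w * (b.factorial * (2 * a + b).factorial * F))
      * (p + 2 * a * p + (1 + 2 * M) * p ^ 2 + (1 + 2 * a) * M * p ^ 3 * (H - 4 * H')))).2 (by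
    have hs : (-1 : ℤ_[p]) ^ a * (-1) ^ (a + b) = (-1) ^ b := by
      rw [pow_add, ← mul_assoc, ← mul_pow]; simp
    -- Here `w` is `1/2`, and `2(2a + b + 1) = 2a + 1 + p`.
    have hL : p * M + ((2 * a + b + 1 : ℕ) : ℤ_[p]) = w * (1 + 2 * a + p * (1 + 2 * M)) := by
      push_cast at h2 ⊢
      linear_combination (-(p * M + (2 * a + b + 1))) * h2 - w * hpc
    have hE : (-1) ^ a * M * (-1 * D) ^ (a + b)
        = (-1) ^ b * M * D ^ (a + b) := by
      rw [mul_pow, ← hs]; ring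
    rw [hL, hE]
    -- The last summand is the `p⁴` cross term of `p(1 + 2M)` with the harmonic correction, absent
    -- from the target.
    refine ⟨D ^ (a + b) * F * (-1) ^ b * b.factorial * (2 * a + b).factorial * M * w
      * ((1 + 2 * a + p * (1 + 2 * M)) * (g - M * h) - (1 + 2 * M) * M * (4 * H' - H)), ?_⟩
    linear_combination (D ^ (a + b) * F * (-1) ^ b * b.factorial * (2 * a + b).factorial * M * w
      * p * (1 + 2 * a + p * (1 + 2 * M))) * (hg - p ^ 2 * M * hh))
  push_cast at key ⊢
  exact key

theorem halfSum_congr_of_eq {n : ℕ} (hn : p = 2 * n + 1) (hp : 3 < p)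
    {d : ℚ} (hd : d ≠ 0) {D : ℤ_[p]} (hD : (D : ℚ_[p]) = (d : ℚ_[p])⁻¹) (M : ℤ_[p]) :
    PadicCongr p 5 (halfSum p d (n + p * M))
        (M * (1 + M) * (p : ℚ_[p]) ^ 2
            / ((4 : ℚ_[p]) ^ (p - 1) * (d : ℚ_[p]) ^ n)
          * (1 + 2 * (p : ℚ_[p]) * (fermatQuotient p 2 : ℚ_[p])
              + (p : ℚ_[p]) ^ 2 * (fermatQuotient p 2 : ℚ_[p]) ^ 2)) := by
  have hp0 : (p : ℚ_[p]) ≠ 0 := by exact_mod_cast (Fact.out : p.Prime).ne_zero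
  have hq : (p : ℚ_[p]) * (fermatQuotient p 2 : ℚ_[p]) = 2 ^ (p - 1) - 1 := by
    rw [fermatQuotient]; push_cast; field_simp
  have hR : (M * (1 + M) * (p : ℚ_[p]) ^ 2
            / ((4 : ℚ_[p]) ^ (p - 1) * (d : ℚ_[p]) ^ n)
          * (1 + 2 * (p : ℚ_[p]) * (fermatQuotient p 2 : ℚ_[p])
              + (p : ℚ_[p]) ^ 2 * (fermatQuotient p 2 : ℚ_[p]) ^ 2))
      = ((M * (1 + M) * p ^ 2 * D ^ n : ℤ_[p]) : ℚ_[p]) := by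
    have h4 : (4 : ℚ_[p]) ^ (p - 1) = (2 ^ (p - 1)) ^ 2 := by
      rw [← pow_mul, mul_comm, pow_mul]; norm_num
    -- The bracket is `(1 + p q)² = (2 ^ (p - 1))²`, so it cancels the denominator exactly.
    have h5 : (1 + 2 * (p : ℚ_[p]) * (fermatQuotient p 2 : ℚ_[p])
        + (p : ℚ_[p]) ^ 2 * (fermatQuotient p 2 : ℚ_[p]) ^ 2) = 4 ^ (p - 1) := by
      rw [h4]
      linear_combination (p * (fermatQuotient p 2 : ℚ_[p]) + 1 + 2 ^ (p - 1)) * hq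
    have h6 : (4 : ℚ_[p]) ^ (p - 1) ≠ 0 := pow_ne_zero _ (by norm_num)
    have h7 : (d : ℚ_[p]) ≠ 0 := by exact_mod_cast hd
    rw [h5]
    push_cast
    rw [hD, inv_pow]
    field_simp
  have hn' : p = 2 * (n + 0) + 1 := hn
  obtain ⟨g, hg⟩ := pow_three_dvd_prod_sub hn' hp M
  have hZ : (p : ℤ_[p]) ∣ ∑ j ∈ range n, ((n + 0 + j + 1 : ℕ) : ℤ_[p]).inv ^ 2 := by
    rw [dvd_iff_toZMod_eq_zero, map_sum]
    refine Eq.trans ?_ (sum_complement_inv_sq_zmod hn' hp)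
    rw [range_zero, sum_empty, zero_add]
    refine sum_congr rfl fun i hi => ?_
    have hi := mem_range.1 hi
    rw [map_pow, toZMod_natCast_inv (by omega) (by omega)]
  obtain ⟨h, hh⟩ := hZ
  have hF := natCast_factorial_mul_inv (p := p) (k := 2 * n) (by omega)
  have hc := prod_centered ((p : ℤ_[p]) * M) n 0
  rw [prod_add_natCast (by omega), range_zero, prod_empty] at hc
  rw [range_zero, prod_empty, hh] at hg
  simp only [add_zero] at hc hg
  rw [hR, halfSum_eq hn hd hD, padicCongr_coe_iff, hc, ← hn]
  set P := ∏ i ∈ range (2 * n), (1 + p * M * ((i + 1 : ℕ) : ℤ_[p]).inv)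
  refine ⟨D ^ n * M * (1 + M) * (g - M * h), ?_⟩
  linear_combination (D ^ n * p ^ 2 * M * (1 + M)) * hg + (D ^ n * p ^ 2 * M * (1 + M) * P) * hF

theorem halfSum_congr_of_gt {n c : ℕ} (hn : p = 2 * n + 1) (hc0 : c ≠ 0) (hcn : c ≤ n)
    {d : ℚ} (hd : d ≠ 0) {D : ℤ_[p]} (hD : (D : ℚ_[p]) = (d : ℚ_[p])⁻¹) (M : ℤ_[p]) :
    PadicCongr p 2 (halfSum p d ((n + c : ℕ) + p * M))
        ((1 + M) * (p : ℚ_[p]) / (d : ℚ_[p]) ^ n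
          * ((Nat.choose (n + c + (n + 1)) (p + 1) : ℕ) : ℚ_[p])) := by
  set C := Nat.choose (n + c + (n + 1)) (p + 1) with hC
  have hR : (1 + M) * (p : ℚ_[p]) / (d : ℚ_[p]) ^ n * (C : ℚ_[p])
      = (((1 + M) * p * D ^ n * C : ℤ_[p]) : ℚ_[p]) := by
    push_cast
    rw [hD, inv_pow, div_eq_mul_inv]
  rw [hR, halfSum_eq hn hd hD, padicCongr_coe_iff, prod_centered_eq_prod_range]
  -- The index whose factor is `p + pM`.
  have hmem : p - c ∈ range (2 * n + 2) := mem_range.2 (by omega)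
  have hcp : c + (p - c) = p := by omega
  rw [← mul_prod_erase _ _ hmem, hcp]
  have hnat : ∏ i ∈ (range (2 * n + 2)).erase (p - c), (c + i)
      = (p + 1) * (2 * n).factorial * C := by
    refine Nat.eq_of_mul_eq_mul_left (Fact.out : p.Prime).pos ?_
    have h := mul_prod_erase _ (fun i => c + i) hmem
    rw [hcp, ← Nat.ascFactorial_eq_prod_range] at h
    obtain ⟨c', rfl⟩ := Nat.exists_eq_succ_of_ne_zero hc0
    rw [h, Nat.succ_eq_add_one, Nat.ascFactorial_eq_factorial_mul_choose, hC,
      show n + (c' + 1) + (n + 1) = c' + (2 * n + 2) by ring, hn, Nat.factorial_succ,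
      Nat.factorial_succ]
    ring
  have hdvd : (p : ℤ_[p]) ∣ ∏ i ∈ (range (2 * n + 2)).erase (p - c), (p * M + ((c + i : ℕ) : ℤ_[p]))
      - (((p + 1) * (2 * n).factorial * C : ℕ) : ℤ_[p]) := by
    rw [← hnat, dvd_iff_toZMod_eq_zero, map_sub, map_natCast, map_prod, Nat.cast_prod, sub_eq_zero]
    exact prod_congr rfl fun i _ => by simp
  obtain ⟨g, hg⟩ := hdvd
  rw [sub_eq_iff_eq_add] at hg
  rw [hg]
  have hF := natCast_factorial_mul_inv (p := p) (k := 2 * n) (by omega)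
  push_cast
  -- The summand `C` absorbs the replacement of `p + 1` by `1`.
  refine ⟨D ^ n * (1 + M) * (((2 * n).factorial : ℤ_[p]).inv * g + C), ?_⟩
  linear_combination (D ^ n * p * (1 + M) * (p + 1) * C) * hF

theorem theorem1p3 (p : ℕ) [Fact p.Prime] (hp : 3 ≤ p)
    (d : ℚ) (hd0 : d ≠ 0) (hd : ¬ (p : ℤ) ∣ d.num)
    (x : ℤ_[p]) (a : ℕ) (ha : a = leastResidue p x)
    (m : ℚ_[p]) (hm : m = ((x : ℚ_[p]) - (a : ℚ_[p])) / (p : ℚ_[p])) :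
    (3 < p → a < (p - 1) / 2 →
      PadicCongr p 4 (halfSum p d x)
        ((-1 : ℚ_[p]) ^ a * m * (-1 / (d : ℚ_[p])) ^ ((p - 1) / 2)
            / (2 * ((Nat.choose (p - 1) (a + (p - 1) / 2) : ℕ) : ℚ_[p]))
          * ((p : ℚ_[p]) + 2 * (a : ℚ_[p]) * (p : ℚ_[p]) + (1 + 2 * m) * (p : ℚ_[p]) ^ 2
              + (1 + 2 * (a : ℚ_[p])) * m * (p : ℚ_[p]) ^ 3
                * ((genHarmonic 2 a : ℚ_[p]) - 4 * (genHarmonic 2 (2 * a) : ℚ_[p])))))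
    ∧
    (3 < p → a = (p - 1) / 2 →
      PadicCongr p 5 (halfSum p d x)
        (m * (1 + m) * (p : ℚ_[p]) ^ 2
            / ((4 : ℚ_[p]) ^ (p - 1) * (d : ℚ_[p]) ^ ((p - 1) / 2))
          * (1 + 2 * (p : ℚ_[p]) * (fermatQuotient p 2 : ℚ_[p])
              + (p : ℚ_[p]) ^ 2 * (fermatQuotient p 2 : ℚ_[p]) ^ 2)))
    ∧
    ((p - 1) / 2 < a →
      PadicCongr p 2 (halfSum p d x)
        ((1 + m) * (p : ℚ_[p]) / (d : ℚ_[p]) ^ ((p - 1) / 2)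
          * ((Nat.choose (a + (p + 1) / 2) (p + 1) : ℕ) : ℚ_[p]))) := by
  obtain ⟨D, hD⟩ := exists_coe_eq_inv hd
  obtain ⟨M, hx⟩ := exists_eq_leastResidue_add x
  have hap : a < p := ha ▸ ZMod.val_lt _
  rw [← ha] at hx
  have hp0 : (p : ℚ_[p]) ≠ 0 := by exact_mod_cast (Fact.out : p.Prime).ne_zero
  have hmM : m = M := by
    rw [hm, hx]; push_cast; field_simp; ring
  obtain ⟨n, hn⟩ : ∃ n, p = 2 * n + 1 :=
    (Nat.Prime.odd_of_ne_two Fact.out (by omega : p ≠ 2))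
  have e1 : (p - 1) / 2 = n := by omega
  have e2 : (p + 1) / 2 = n + 1 := by omega
  clear ha hm
  rw [e1, e2, hmM, hx]
  refine ⟨fun hp3 han => ?_, fun hp3 han => ?_, fun han => ?_⟩
  -- This yields `n = a + b + 1`, hence the shift to `b + 1` below.
  · obtain ⟨b, rfl⟩ := Nat.exists_eq_add_of_lt han
    have h := halfSum_congr_of_lt (p := p) (a := a) (b := b + 1) hn hp3 hd0 hD M
    rwa [show 2 * a + (b + 1) + (b + 1) = p - 1 by omega,
      show 2 * a + (b + 1) = a + (a + b + 1) by ring] at h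
  · subst han
    exact halfSum_congr_of_eq hn hp3 hd0 hD M
  · obtain ⟨c, rfl⟩ := Nat.exists_eq_add_of_lt han
    exact halfSum_congr_of_gt (c := c + 1) hn (by omega) (by omega) hd0 hD M
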